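/- For symmetric $n\times n$ matrices write $A\bullet B=\sum_{i,j}A_{ij}B_{ij}$, and let $\mathbb S^n_+$ be the cone of positive semidefinite matrices in the space $\mathbb S^n$ of real symmetric matrices. For a set $S\subseteq\mathbb S^n$ put $S^\perp=\{Z\in\mathbb S^n: Z\bullet X=0\ \forall X\in S\}$. Let $K=\{1,\dots,m\}$, $A_0,\dots,A_m\in\mathbb S^n$, $b\in\mathbb R^m$, and for $t\ge 0$ let $E_k(t)\in\mathbb S^n$ ($k\in K$) with $E_k(0)=O$ and $E_k$ continuous at $t=0$. Consider $$(P)\ \sup\Big\{b^Ty: A_0-\sum_{k\in K} y_kA_k=Z,\ Z\in\mathbb S^n_+\Big\},\qquad (D)\ \inf\{A_0\bullet X: A_k\bullet X=b_k\ (k\in K),\ X\in\mathbb S^n_+\},$$ $$(D_t)\ \inf\{A_0\bullet X: (A_k+E_k(t))\bullet X=b_k\ (k\in K),\ X\in\mathbb S^n_+\}.$$ The minimal face of $(D)$ (of $(D_t)$) is the intersection of all faces of $\mathbb S^n_+$ containing its feasible region; let $F_{\min}$ be the minimal face of $(D)$. Assume: (D1) $(D)$ is feasible and $(P)$ is strictly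 feasible (has a feasible point with $Z$ positive definite); (D2) $A_1,\dots,A_m$ are linearly independent; (D3) $(D_t)$ is feasible for all sufficiently small $t>0$. Let $(\hat y^1,\hat U^1,\hat V^1),\dots,(\hat y^s,\hat U^s,\hat V^s)$ be a facial reduction sequence of $(D)$: there are $F_0=\mathbb S^n_+,F_1,\dots,F_s=F_{\min}$ such that for $i=1,\dots,s$ one has $\hat y^i\in\mathbb R^m$, $\hat U^i\in\mathbb S^n_+$, $\hat V^i\in F_{i-1}^\perp$, $b^T\hat y^i=0$, $-\sum_{k\in K}\hat y^i_kA_k=\hat U^i+\hat V^i\notin F_{i-1}^\perp$ and $F_i=F_{i-1}\cap\{\hat U^i\}^\perp$. Put $\hat K=\{k\in K:\hat y^i_k=0\ \text{for all } i=1,\dots,s\}$. Suppose that for all sufficiently small $t>0$ one has $E_k(t)=O$ for $k\notin\hat K$ and $E_k(t)\in F_{\min}^\perp$ for $k\in\hat K$. Then for all sufficiently small $t>0$ the minimal face of $(D_t)$ equals $F_{\min}$. Moreover the rank condition holds: $F_{\min}$ can be written as $\Big\{Q\begin{pmatrix}O&O\\O&X\end{pmatrix}Q^T: X\in\mathbb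 S^r_+\Big\}$ with $0\le r\le n$ and $Q$ orthogonal, and for every such $Q$ and $r$ there is $\delta>0$ such that for all $t\in[0,\delta]$ $$\dim\big\langle (Q^T(A_k+E_k(t))Q)_3: k\in K\big\rangle=\dim\big\langle (Q^TA_kQ)_3: k\in K\big\rangle,$$ where $\langle\cdot\rangle$ is the linear span and $M_3$ denotes the right bottom $r\times r$ block of $M$. -/

import Mathlib

open Filter Topology

/-- The trace inner product `A • B = ∑ i j, A i j * B i j` of two `n × n` matrices. -/
def matInner {n : ℕ} (A B : Matrix (Fin n) (Fin n) ℝ) : ℝ :=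
  ∑ i, ∑ j, A i j * B i j

/-- The cone of `n × n` real symmetric positive semidefinite matrices. -/
def psdCone (n : ℕ) : Set (Matrix (Fin n) (Fin n) ℝ) :=
  {X | X.PosSemidef}

/-- The orthogonal complement of a set, inside the space of symmetric matrices. -/
def symPerp {n : ℕ} (S : Set (Matrix (Fin n) (Fin n) ℝ)) : Set (Matrix (Fin n) (Fin n) ℝ) :=
  {Z | Z.IsSymm ∧ ∀ X ∈ S, matInner Z X = 0}

/-- A face of a convex set `C`: a convex subset `F` of `C` such that both end points in `C` of an
open segment that meets `F` belong to `F`. -/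
def IsFace {E : Type*} [AddCommGroup E] [Module ℝ E] (C F : Set E) : Prop :=
  Convex ℝ F ∧ IsExtreme ℝ C F

/-- The minimal face of `C` containing `S`: the intersection of all faces of `C` containing `S`. -/
def minFace {E : Type*} [AddCommGroup E] [Module ℝ E] (C S : Set E) : Set E :=
  ⋂₀ {F | IsFace C F ∧ S ⊆ F}

/-- The feasible region of the dual problem
`inf {A₀ • X : A k • X = b k for all k, X positive semidefinite}`. -/
def dualFeasible {n m : ℕ} (A : Fin m → Matrix (Fin n) (Fin n) ℝ) (b : Fin m → ℝ) :
    Set (Matrix (Fin n) (Fin n) ℝ) :=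
  {X | X ∈ psdCone n ∧ ∀ k, matInner (A k) X = b k}

/-- Strict feasibility of the primal problem
`sup {∑ k, b k * y k : A₀ - ∑ k, y k • A k = Z, Z positive semidefinite}`. -/
def PrimalStrictlyFeasible {n m : ℕ} (A₀ : Matrix (Fin n) (Fin n) ℝ)
    (A : Fin m → Matrix (Fin n) (Fin n) ℝ) : Prop :=
  ∃ (y : Fin m → ℝ) (Z : Matrix (Fin n) (Fin n) ℝ), A₀ - ∑ k, y k • A k = Z ∧ Z.PosDef

/-- The minimal face of the dual problem. -/
def dualMinFace {n m : ℕ} (A : Fin m → Matrix (Fin n) (Fin n) ℝ) (b : Fin m → ℝ) :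
    Set (Matrix (Fin n) (Fin n) ℝ) :=
  minFace (psdCone n) (dualFeasible A b)

/-- `(y, U, V)` is a reducing certificate at the face `F`: it solves the discriminant system
`bᵀy = 0`, `-∑ k, y k • A k = U + V`, `U + V ∉ F^⊥`, with `U` positive semidefinite, `V ∈ F^⊥`. -/
structure IsReducingCertificate {n m : ℕ} (A : Fin m → Matrix (Fin n) (Fin n) ℝ) (b : Fin m → ℝ)
    (F : Set (Matrix (Fin n) (Fin n) ℝ)) (y : Fin m → ℝ) (U V : Matrix (Fin n) (Fin n) ℝ) :
    Prop where
  psd : U ∈ psdCone n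
  perp : V ∈ symPerp F
  orth : ∑ k, b k * y k = 0
  eq : -∑ k, y k • A k = U + V
  notMem : U + V ∉ symPerp F

/-- `(y i, U i, V i)`, `i < s`, is a facial reduction sequence of the dual problem: starting from
the whole cone `F 0`, each triple is a reducing certificate at the current face `F i`, the next face
is `F i ∩ {U i}^⊥`, and the last face is the minimal face. -/
def IsFacialReductionSequence {n m s : ℕ} (A : Fin m → Matrix (Fin n) (Fin n) ℝ) (b : Fin m → ℝ)
    (y : Fin s → Fin m → ℝ) (U V : Fin s → Matrix (Fin n) (Fin n) ℝ) : Prop :=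
  ∃ F : Fin (s + 1) → Set (Matrix (Fin n) (Fin n) ℝ),
    F 0 = psdCone n ∧
    (∀ i : Fin s, IsReducingCertificate A b (F i.castSucc) (y i) (U i) (V i) ∧
      F i.succ = F i.castSucc ∩ symPerp {U i}) ∧
    F (Fin.last s) = dualMinFace A b

/-- The set of indices `k` such that the `k`-th entry of every `y i` vanishes. -/
def unusedIndices {m s : ℕ} (y : Fin s → Fin m → ℝ) : Set (Fin m) :=
  {k | ∀ i, y i k = 0}

/-- The standing condition on a dual problem and its perturbations
`inf {A₀ • X : (A k + E k t) • X = b k for all k, X positive semidefinite}`. -/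
structure PerturbCondition {n m : ℕ} (A₀ : Matrix (Fin n) (Fin n) ℝ)
    (A : Fin m → Matrix (Fin n) (Fin n) ℝ) (b : Fin m → ℝ)
    (E : Fin m → ℝ → Matrix (Fin n) (Fin n) ℝ) : Prop where
  dual_feasible : (dualFeasible A b).Nonempty
  primal_strictly_feasible : PrimalStrictlyFeasible A₀ A
  linearIndependent : LinearIndependent ℝ A
  perturbed_feasible : ∀ᶠ t in 𝓝[>] (0 : ℝ), (dualFeasible (fun k => A k + E k t) b).Nonempty

/-- The splitting of the indices `0, …, n - 1` into the first `p` and the last `r`. -/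
def blockEquiv {n p r : ℕ} (h : p + r = n) : Fin p ⊕ Fin r ≃ Fin n :=
  finSumFinEquiv.trans (finCongr h)

/-- The right bottom `r × r` block of an `n × n` matrix. -/
def bottomBlock {n p r : ℕ} (h : p + r = n) (M : Matrix (Fin n) (Fin n) ℝ) :
    Matrix (Fin r) (Fin r) ℝ :=
  (M.submatrix (blockEquiv h) (blockEquiv h)).toBlocks₂₂

/-- The `n × n` matrix with right bottom block `X` and all other entries zero. -/
def embedBottom {n p r : ℕ} (h : p + r = n) (X : Matrix (Fin r) (Fin r) ℝ) :
    Matrix (Fin n) (Fin n) ℝ :=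
  (Matrix.fromBlocks (0 : Matrix (Fin p) (Fin p) ℝ) 0 0 X).submatrix
    (blockEquiv h).symm (blockEquiv h).symm

/-- The orthogonal matrix `Q`, with the block sizes `p + r = n`, is associated to the face `F`:
`F` is the set of the matrices `Q * diag(0, X) * Qᵀ` with `X` positive semidefinite of size `r`. -/
def IsAssociated {n p r : ℕ} (h : p + r = n) (Q : Matrix (Fin n) (Fin n) ℝ)
    (F : Set (Matrix (Fin n) (Fin n) ℝ)) : Prop :=
  Q ∈ Matrix.orthogonalGroup (Fin n) ℝ ∧
    F = {Y | ∃ X ∈ psdCone r, Y = Q * embedBottom h X * Q.transpose}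

/-- The dimension of the span of the right bottom blocks of `Qᵀ * A k * Q`. -/
noncomputable def blockRank {n m p r : ℕ} (h : p + r = n) (Q : Matrix (Fin n) (Fin n) ℝ)
    (A : Fin m → Matrix (Fin n) (Fin n) ℝ) : ℕ :=
  Module.finrank ℝ
    (Submodule.span ℝ (Set.range fun k => bottomBlock h (Q.transpose * A k * Q)))

/-- The rank condition: there are orthogonal matrices associated to the minimal face of the
unperturbed dual problem, and for each of them (the choice does not matter) the dimension of the
span of the blocks is the same for the perturbed as for the unperturbed matrices, for all `t` in
some interval `[0, δ]` with `δ > 0`. -/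
def DualRankCondition {n m : ℕ} (A : Fin m → Matrix (Fin n) (Fin n) ℝ) (b : Fin m → ℝ)
    (E : Fin m → ℝ → Matrix (Fin n) (Fin n) ℝ) : Prop :=
  (∃ (p r : ℕ) (h : p + r = n) (Q : Matrix (Fin n) (Fin n) ℝ),
    IsAssociated h Q (dualMinFace A b)) ∧
  ∀ (p r : ℕ) (h : p + r = n) (Q : Matrix (Fin n) (Fin n) ℝ),
    IsAssociated h Q (dualMinFace A b) →
    ∃ δ > 0, ∀ t ∈ Set.Icc (0 : ℝ) δ,
      blockRank h Q (fun k => A k + E k t) = blockRank h Q A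

/-! The vectors of a facial reduction sequence involve only those `A k` with `k` outside
`unusedIndices y`, and these are not perturbed. The same certificates therefore confine the feasible
region of the perturbed problem to the minimal face of the original one
(`IsFacialReductionSequence.dualFeasible_subset`). On that face every `E k t` pairs to zero, so the
two feasible regions coincide, and hence so do their minimal faces (`dualFeasible_add_eq`). For the
rank condition, the minimal face is exposed by the sum of the `U i`
(`IsFacialReductionSequence.dualMinFace_eq`), and diagonalizing this sum yields a `Q`. For any
associated `Q`, a matrix orthogonal to the face has zero bottom block, so the blocks themselves do
not change (`IsAssociated.bottomBlock_eq_zero`). -/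

/-! ### The trace inner product and positive semidefinite matrices. -/

open Matrix in
theorem matInner_eq_trace {n : ℕ} (A B : Matrix (Fin n) (Fin n) ℝ) :
    matInner A B = (Aᵀ * B).trace := by
  simp only [matInner, trace, diag_apply, mul_apply, transpose_apply]
  exact Finset.sum_comm

theorem matInner_add_left {n : ℕ} (A B C : Matrix (Fin n) (Fin n) ℝ) :
    matInner (A + B) C = matInner A C + matInner B C := by
  simp [matInner_eq_trace, Matrix.add_mul]

theorem matInner_neg_left {n : ℕ} (A B : Matrix (Fin n) (Fin n) ℝ) :
    matInner (-A) B = -matInner A B := by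
  simp [matInner_eq_trace]

theorem matInner_sum_left {n : ℕ} {ι : Type*} (s : Finset ι)
    (A : ι → Matrix (Fin n) (Fin n) ℝ) (B : Matrix (Fin n) (Fin n) ℝ) :
    matInner (∑ i ∈ s, A i) B = ∑ i ∈ s, matInner (A i) B := by
  simp [matInner_eq_trace, Matrix.transpose_sum, Matrix.sum_mul, Matrix.trace_sum]

theorem matInner_smul_left {n : ℕ} (c : ℝ) (A B : Matrix (Fin n) (Fin n) ℝ) :
    matInner (c • A) B = c * matInner A B := by
  simp [matInner_eq_trace]

theorem matInner_comm {n : ℕ} (A B : Matrix (Fin n) (Fin n) ℝ) :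
    matInner A B = matInner B A := by
  simp [matInner, mul_comm]

open Matrix in
theorem matInner_conj {n : ℕ} (W Q N : Matrix (Fin n) (Fin n) ℝ) :
    matInner W (Q * N * Qᵀ) = matInner (Qᵀ * W * Q) N := by
  simp only [matInner_eq_trace, transpose_mul, transpose_transpose, Matrix.mul_assoc]
  rw [trace_mul_comm Qᵀ]
  simp only [Matrix.mul_assoc]

theorem matInner_diagonal {n : ℕ} (c : Fin n → ℝ) (M : Matrix (Fin n) (Fin n) ℝ) :
    matInner (Matrix.diagonal c) M = ∑ i, c i * M i i := by
  simp [matInner, Matrix.diagonal_apply]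

open Matrix in
theorem matInner_vecMulVec {n : ℕ} (M : Matrix (Fin n) (Fin n) ℝ) (v : Fin n → ℝ) :
    matInner M (vecMulVec v v) = v ⬝ᵥ M *ᵥ v := by
  simp only [matInner, vecMulVec_apply, dotProduct, mulVec, Finset.mul_sum]
  exact Finset.sum_congr rfl fun i _ => Finset.sum_congr rfl fun j _ => by ring

-- Factoring `B = Cᴴ * C` turns the pairing into the trace of a congruence of `Aᵀ`.
open Matrix MatrixOrder in
theorem matInner_nonneg {n : ℕ} {A B : Matrix (Fin n) (Fin n) ℝ}
    (hA : A.PosSemidef) (hB : B.PosSemidef) : 0 ≤ matInner A B := by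
  obtain ⟨C, rfl⟩ := CStarAlgebra.nonneg_iff_eq_star_mul_self.mp hB.nonneg
  have h := (hA.transpose.mul_mul_conjTranspose_same C).trace_nonneg
  rwa [matInner_eq_trace, star_eq_conjTranspose, ← Matrix.mul_assoc, trace_mul_comm,
    ← Matrix.mul_assoc]

open Matrix in
/-- A symmetric matrix orthogonal to the positive semidefinite cone vanishes. -/
theorem eq_zero_of_matInner_psd_eq_zero {n : ℕ} {M : Matrix (Fin n) (Fin n) ℝ} (hM : M.IsSymm)
    (h : ∀ X ∈ psdCone n, matInner M X = 0) : M = 0 := by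
  have key : ∀ v : Fin n → ℝ, v ⬝ᵥ M *ᵥ v = 0 := fun v => by
    rw [← matInner_vecMulVec]
    have hv : (vecMulVec v v).PosSemidef := by simpa using posSemidef_vecMulVec_self_star v
    exact h _ hv
  ext i j
  -- Polarization: the quadratic form at `eᵢ + eⱼ`, `eᵢ` and `eⱼ` determines `M i j`.
  have hij := key (Pi.single i 1 + Pi.single j 1)
  have hi := key (Pi.single i 1)
  have hj := key (Pi.single j 1)
  have hs := hM.apply i j
  simp [mulVec_add, add_dotProduct, dotProduct_add] at hij hi hj
  change M i j = 0
  linarith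

-- The principal minor on `i, j` reduces to `-(M i j)²`, yet is nonnegative.
open Matrix in
theorem Matrix.PosSemidef.apply_eq_zero_of_diag_eq_zero {n : ℕ} {M : Matrix (Fin n) (Fin n) ℝ}
    (hM : M.PosSemidef) {i : Fin n} (hi : M i i = 0) (j : Fin n) : M i j = 0 := by
  have h := (hM.submatrix ![i, j]).det_nonneg
  have hs : M j i = M i j := by simpa using hM.isHermitian.apply i j
  rw [det_fin_two] at h
  have h' : 0 ≤ M i i * M j j - M i j * M j i := h
  rw [hi, hs] at h'
  exact mul_self_eq_zero.mp (by linarith [mul_self_nonneg (M i j)])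

/-! ### Block form of exposed faces. -/

open Matrix in
theorem posSemidef_embedBottom {n p r : ℕ} (h : p + r = n) {X : Matrix (Fin r) (Fin r) ℝ}
    (hX : X.PosSemidef) : (embedBottom h X).PosSemidef := by
  have : embedBottom h X =
      (fromRows (0 : Matrix (Fin p) (Fin r) ℝ) 1 * X *
        (fromRows (0 : Matrix (Fin p) (Fin r) ℝ) 1)ᴴ).submatrix
        (blockEquiv h).symm (blockEquiv h).symm := by
    rw [embedBottom, conjTranspose_fromRows_eq_fromCols_conjTranspose, fromRows_mul,
      fromRows_mul_fromCols]
    simp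
  rw [this]
  exact (hX.mul_mul_conjTranspose_same _).submatrix _

theorem matInner_embedBottom {n p r : ℕ} (h : p + r = n) (M : Matrix (Fin n) (Fin n) ℝ)
    (X : Matrix (Fin r) (Fin r) ℝ) :
    matInner M (embedBottom h X) = matInner (bottomBlock h M) X := by
  simp only [matInner]
  rw [← (blockEquiv h).sum_comp]
  simp_rw [← (blockEquiv h).sum_comp (fun j => M _ j * _)]
  simp [embedBottom, bottomBlock, Matrix.toBlocks₂₂]

open Matrix in
/-- An orthogonal diagonalization of `W ≥ 0` listing the kernel last is associated to the face
of the positive semidefinite cone exposed by `W`. -/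
theorem isAssociated_of_diagonal {n p r : ℕ} (h : p + r = n) {Q W : Matrix (Fin n) (Fin n) ℝ}
    (hQ : Q ∈ orthogonalGroup (Fin n) ℝ) {c : Fin n → ℝ} (hW : Qᵀ * W * Q = diagonal c)
    (hpos : ∀ i, 0 < c (blockEquiv h (Sum.inl i)))
    (hzero : ∀ i, c (blockEquiv h (Sum.inr i)) = 0) :
    IsAssociated h Q {X | X ∈ psdCone n ∧ matInner W X = 0} := by
  refine ⟨hQ, Set.ext fun Y => ⟨?_, ?_⟩⟩
  · rintro ⟨hY, hWY⟩
    have hQQ : Q * Qᵀ = 1 := by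
      simpa [star_eq_conjTranspose] using (mem_orthogonalGroup_iff (Fin n) ℝ).mp hQ
    have hM : (Qᵀ * Y * Q).PosSemidef := by simpa using hY.conjTranspose_mul_mul_same Q
    obtain ⟨M, hMdef⟩ : ∃ M, M = Qᵀ * Y * Q := ⟨_, rfl⟩
    rw [← hMdef] at hM
    have hYM : Y = Q * M * Qᵀ := by
      rw [hMdef, show Q * (Qᵀ * Y * Q) * Qᵀ = (Q * Qᵀ) * Y * (Q * Qᵀ) by
        simp only [Matrix.mul_assoc], hQQ, Matrix.one_mul, Matrix.mul_one]
    rw [hYM, matInner_conj, hW, matInner_diagonal] at hWY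
    have hc : ∀ i, 0 ≤ c i := fun i => by
      obtain ⟨a | a, rfl⟩ := (blockEquiv h).surjective i
      exacts [(hpos a).le, (hzero a).ge]
    -- A vanishing sum of nonnegative terms: `M` has zero diagonal wherever `c` is positive, which
    -- kills the corresponding rows and columns.
    have hdiag := (Finset.sum_eq_zero_iff_of_nonneg
      fun i _ => mul_nonneg (hc i) hM.diag_nonneg).mp hWY
    have hrow : ∀ a j, M (blockEquiv h (Sum.inl a)) j = 0 := fun a j =>
      hM.apply_eq_zero_of_diag_eq_zero
        ((mul_eq_zero.mp (hdiag _ (Finset.mem_univ _))).resolve_left (hpos a).ne') j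
    have hcol : ∀ a j, M j (blockEquiv h (Sum.inl a)) = 0 := fun a j => by
      rw [← hrow a j]
      simpa using hM.isHermitian.apply (blockEquiv h (Sum.inl a)) j
    refine ⟨bottomBlock h M, hM.submatrix (blockEquiv h ∘ Sum.inr), ?_⟩
    rw [hYM]
    congr 2
    ext i j
    obtain ⟨i, rfl⟩ := (blockEquiv h).surjective i
    obtain ⟨j, rfl⟩ := (blockEquiv h).surjective j
    rcases i with i | i <;> rcases j with j | j <;>
      simp [embedBottom, bottomBlock, toBlocks₂₂, hrow, hcol]
  · rintro ⟨X, hX, rfl⟩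
    have hpsd : (Q * embedBottom h X * Qᵀ).PosSemidef := by
      simpa using (posSemidef_embedBottom h hX).mul_mul_conjTranspose_same Q
    refine ⟨hpsd, ?_⟩
    have hblock : bottomBlock h (diagonal c) = 0 := by
      ext i j
      rcases eq_or_ne i j with rfl | hij
      · simp [bottomBlock, toBlocks₂₂, hzero]
      · simp [bottomBlock, toBlocks₂₂, hij]
    rw [matInner_conj, hW, matInner_embedBottom, hblock]
    simp [matInner]

open Matrix in
theorem exists_isAssociated_exposed {n : ℕ} {W : Matrix (Fin n) (Fin n) ℝ} (hW : W.PosSemidef) :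
    ∃ (p r : ℕ) (h : p + r = n) (Q : Matrix (Fin n) (Fin n) ℝ),
      IsAssociated h Q {X | X ∈ psdCone n ∧ matInner W X = 0} := by
  obtain ⟨d, hd⟩ : ∃ d, d = hW.isHermitian.eigenvalues := ⟨_, rfl⟩
  have hd0 : ∀ i, 0 ≤ d i := fun i => hd ▸ hW.eigenvalues_nonneg i
  have hcard : Fintype.card {i // d i ≠ 0} + Fintype.card {i // ¬d i ≠ 0} = n := by
    rw [← Fintype.card_sum, Fintype.card_congr (Equiv.sumCompl fun i => d i ≠ 0), Fintype.card_fin]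
  refine ⟨_, _, hcard, ?_⟩
  -- Reorders the eigenvectors so that those with nonzero eigenvalue come first.
  let e : Fin n ≃ Fin n := (blockEquiv hcard).symm.trans
    (((Fintype.equivFin {i // d i ≠ 0}).symm.sumCongr
      (Fintype.equivFin {i // ¬d i ≠ 0}).symm).trans (Equiv.sumCompl _))
  let P : Matrix (Fin n) (Fin n) ℝ := hW.isHermitian.eigenvectorUnitary
  have hP : P * Pᵀ = 1 := by
    simpa [star_eq_conjTranspose] using
      mem_unitaryGroup_iff.mp hW.isHermitian.eigenvectorUnitary.2
  have hdiag : Pᵀ * W * P = diagonal d := by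
    have := hW.isHermitian.conjStarAlgAut_star_eigenvectorUnitary
    rw [Unitary.conjStarAlgAut_star_apply] at this
    simpa [star_eq_conjTranspose, ← hd, Function.comp_def] using this
  refine ⟨P.submatrix id e, isAssociated_of_diagonal hcard (c := d ∘ e) ?_ ?_ ?_ ?_⟩
  · rw [mem_orthogonalGroup_iff, transpose_submatrix, submatrix_mul_equiv, hP, submatrix_id_id]
  · have : (P.submatrix id e)ᵀ * W * P.submatrix id e = (Pᵀ * W * P).submatrix e e := by
      ext i j
      simp [mul_apply]
    rw [this, hdiag, submatrix_diagonal_equiv]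
  · intro i
    have := ((Fintype.equivFin {i // d i ≠ 0}).symm i).2
    refine lt_of_le_of_ne (hd0 _) ?_
    simpa [e] using this.symm
  · intro i
    have := ((Fintype.equivFin {i // ¬d i ≠ 0}).symm i).2
    simpa [e] using this

/-! ### Facial reduction under perturbation. -/

theorem dualFeasible_subset_dualMinFace {n m : ℕ} (A : Fin m → Matrix (Fin n) (Fin n) ℝ)
    (b : Fin m → ℝ) : dualFeasible A b ⊆ dualMinFace A b :=
  Set.subset_sInter fun _ hF => hF.2

/-- A feasible point of the dual problem in the face `F` lies in the next face of a facial
reduction step at `F`. -/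
theorem IsReducingCertificate.mem_inter {n m : ℕ} {A : Fin m → Matrix (Fin n) (Fin n) ℝ}
    {b : Fin m → ℝ} {F : Set (Matrix (Fin n) (Fin n) ℝ)} {y : Fin m → ℝ}
    {U V : Matrix (Fin n) (Fin n) ℝ} {B : Fin m → Matrix (Fin n) (Fin n) ℝ}
    (hc : IsReducingCertificate A b F y U V) (hB : ∑ k, y k • B k = ∑ k, y k • A k)
    {X : Matrix (Fin n) (Fin n) ℝ} (hX : X ∈ dualFeasible B b) (hXF : X ∈ F) :
    X ∈ F ∩ symPerp {U} := by
  refine ⟨hXF, by simpa [Matrix.IsSymm] using hX.1.isHermitian, ?_⟩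
  rintro _ rfl
  -- Pairing the certificate with `X` leaves `-bᵀy = U • X`, as `V` vanishes on `F`.
  have h := congrArg (matInner · X) hc.eq
  simp only [← hB, matInner_neg_left, matInner_sum_left, matInner_smul_left, matInner_add_left,
    hc.perp.2 X hXF, hX.2] at h
  rw [matInner_comm]
  have horth := hc.orth
  simp only [mul_comm (b _)] at horth
  linarith

theorem IsFacialReductionSequence.dualFeasible_subset {n m s : ℕ}
    {A B : Fin m → Matrix (Fin n) (Fin n) ℝ} {b : Fin m → ℝ} {y : Fin s → Fin m → ℝ}
    {U V : Fin s → Matrix (Fin n) (Fin n) ℝ} (hseq : IsFacialReductionSequence A b y U V)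
    (hB : ∀ k ∉ unusedIndices y, B k = A k) : dualFeasible B b ⊆ dualMinFace A b := by
  obtain ⟨F, h0, hstep, hlast⟩ := hseq
  intro X hX
  rw [← hlast]
  refine Fin.induction (motive := fun i => X ∈ F i) (h0 ▸ hX.1) (fun i ih => ?_) (Fin.last s)
  rw [(hstep i).2]
  refine (hstep i).1.mem_inter (Finset.sum_congr rfl fun k _ => ?_) hX ih
  by_cases hk : k ∈ unusedIndices y
  · simp [hk i]
  · rw [hB k hk]

/-- Each step cuts by one `U i`; as all `U i • X` are nonnegative, they vanish together exactly when
their sum does. -/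
theorem IsFacialReductionSequence.dualMinFace_eq {n m s : ℕ}
    {A : Fin m → Matrix (Fin n) (Fin n) ℝ} {b : Fin m → ℝ} {y : Fin s → Fin m → ℝ}
    {U V : Fin s → Matrix (Fin n) (Fin n) ℝ} (hseq : IsFacialReductionSequence A b y U V) :
    dualMinFace A b = {X | X ∈ psdCone n ∧ matInner (∑ i, U i) X = 0} := by
  obtain ⟨F, h0, hstep, hlast⟩ := hseq
  have hF : ∀ j, F j = {X | X ∈ psdCone n ∧ ∀ i : Fin s, i.castSucc < j → matInner (U i) X = 0} := by
    refine Fin.induction ?_ fun j ih => ?_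
    · simp [h0]
    · rw [(hstep j).2, ih]
      ext X
      simp only [Set.mem_inter_iff, Set.mem_ofPred_eq, symPerp, Set.mem_singleton_iff, forall_eq,
        Fin.castSucc_lt_succ_iff, Fin.castSucc_lt_castSucc_iff]
      constructor
      · rintro ⟨⟨hX, h⟩, -, hj⟩
        refine ⟨hX, fun i hi => ?_⟩
        rcases hi.lt_or_eq with hi | rfl
        · exact h i hi
        · rwa [matInner_comm]
      · rintro ⟨hX, h⟩
        refine ⟨⟨hX, fun i hi => h i hi.le⟩, by simpa [Matrix.IsSymm] using hX.isHermitian, ?_⟩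
        rw [matInner_comm]
        exact h j le_rfl
  rw [← hlast, hF]
  ext X
  refine and_congr_right fun hX => ?_
  rw [matInner_sum_left,
    Finset.sum_eq_zero_iff_of_nonneg fun i _ => matInner_nonneg (hstep i).1.psd hX]
  simp [Fin.castSucc_lt_last]

theorem dualFeasible_add_eq {n m : ℕ} {A E : Fin m → Matrix (Fin n) (Fin n) ℝ} {b : Fin m → ℝ}
    (hE : ∀ k, E k ∈ symPerp (dualMinFace A b))
    (hsub : dualFeasible (fun k => A k + E k) b ⊆ dualMinFace A b) :
    dualFeasible (fun k => A k + E k) b = dualFeasible A b := by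
  have key : ∀ X ∈ dualMinFace A b, ∀ k, matInner (A k + E k) X = matInner (A k) X :=
    fun X hX k => by rw [matInner_add_left, (hE k).2 X hX, add_zero]
  ext X
  constructor
  · exact fun hX => ⟨hX.1, fun k => (key X (hsub hX) k).symm.trans (hX.2 k)⟩
  · exact fun hX => ⟨hX.1, fun k =>
      (key X (dualFeasible_subset_dualMinFace A b hX) k).trans (hX.2 k)⟩

/-! ### The rank condition and the main theorem. -/

-- Testing `Z` on the members of `F` tests the block on the whole smaller cone, and only the zero
-- symmetric matrix is orthogonal to that.
open Matrix in
theorem IsAssociated.bottomBlock_eq_zero {n p r : ℕ} {h : p + r = n}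
    {Q : Matrix (Fin n) (Fin n) ℝ} {F : Set (Matrix (Fin n) (Fin n) ℝ)}
    (hQ : IsAssociated h Q F) {Z : Matrix (Fin n) (Fin n) ℝ} (hZ : Z ∈ symPerp F) :
    bottomBlock h (Qᵀ * Z * Q) = 0 := by
  refine eq_zero_of_matInner_psd_eq_zero ?_ fun X hX => ?_
  · have : (Qᵀ * Z * Q).IsSymm := by
      simp [IsSymm, transpose_mul, hZ.1.eq, Matrix.mul_assoc]
    exact this.submatrix (blockEquiv h ∘ Sum.inr)
  · rw [← matInner_embedBottom, ← matInner_conj]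
    exact hZ.2 _ (hQ.2 ▸ ⟨X, hX, rfl⟩)

theorem IsAssociated.blockRank_add {n m p r : ℕ} {h : p + r = n}
    {Q : Matrix (Fin n) (Fin n) ℝ} {F : Set (Matrix (Fin n) (Fin n) ℝ)}
    (hQ : IsAssociated h Q F) (A : Fin m → Matrix (Fin n) (Fin n) ℝ)
    {E : Fin m → Matrix (Fin n) (Fin n) ℝ} (hE : ∀ k, E k ∈ symPerp F) :
    blockRank h Q (fun k => A k + E k) = blockRank h Q A := by
  have key : ∀ k, bottomBlock h (Q.transpose * (A k + E k) * Q) =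
      bottomBlock h (Q.transpose * A k * Q) := fun k => by
    have hadd : bottomBlock h (Q.transpose * (A k + E k) * Q) =
        bottomBlock h (Q.transpose * A k * Q) + bottomBlock h (Q.transpose * E k * Q) := by
      rw [Matrix.mul_add, Matrix.add_mul]
      rfl
    rw [hadd, hQ.bottomBlock_eq_zero (hE k), add_zero]
  rw [blockRank, blockRank, funext key]

theorem zero_mem_symPerp {n : ℕ} (S : Set (Matrix (Fin n) (Fin n) ℝ)) : 0 ∈ symPerp S :=
  ⟨Matrix.isSymm_zero, by simp [matInner]⟩

theorem corollary4p1 {n m s : ℕ}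
    (A₀ : Matrix (Fin n) (Fin n) ℝ) (hA₀ : A₀.IsSymm)
    (A : Fin m → Matrix (Fin n) (Fin n) ℝ) (hA : ∀ k, (A k).IsSymm)
    (b : Fin m → ℝ)
    (E : Fin m → ℝ → Matrix (Fin n) (Fin n) ℝ)
    (hE_symm : ∀ k, ∀ t, 0 ≤ t → (E k t).IsSymm)
    (hE_zero : ∀ k, E k 0 = 0)
    (hE_cont : ∀ k, ContinuousWithinAt (E k) (Set.Ici 0) 0)
    (hcond : PerturbCondition A₀ A b E)
    (y : Fin s → Fin m → ℝ) (U V : Fin s → Matrix (Fin n) (Fin n) ℝ)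
    (hseq : IsFacialReductionSequence A b y U V)
    (hE_used : ∀ᶠ t in 𝓝[>] (0 : ℝ), ∀ k ∉ unusedIndices y, E k t = 0)
    (hE_unused : ∀ᶠ t in 𝓝[>] (0 : ℝ), ∀ k ∈ unusedIndices y,
      E k t ∈ symPerp (dualMinFace A b)) :
    (∀ᶠ t in 𝓝[>] (0 : ℝ), dualMinFace (fun k => A k + E k t) b = dualMinFace A b) ∧
      DualRankCondition A b E := by
  have hE : ∀ᶠ t in 𝓝[>] (0 : ℝ), ∀ k, E k t ∈ symPerp (dualMinFace A b) := by
    filter_upwards [hE_used, hE_unused] with t h₁ h₂ k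
    by_cases hk : k ∈ unusedIndices y
    · exact h₂ k hk
    · exact h₁ k hk ▸ zero_mem_symPerp _
  refine ⟨?_, ?_, fun p r h Q hQ => ?_⟩
  · filter_upwards [hE_used, hE] with t h₁ h₂
    have hsub : dualFeasible (fun k => A k + E k t) b ⊆ dualMinFace A b :=
      hseq.dualFeasible_subset fun k hk => by simp [h₁ k hk]
    rw [dualMinFace, dualFeasible_add_eq h₂ hsub, dualMinFace]
  · rw [hseq.dualMinFace_eq]
    refine exists_isAssociated_exposed (Matrix.posSemidef_sum _ fun i _ => ?_)
    obtain ⟨F, -, hstep, -⟩ := hseq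
    exact (hstep i).1.psd
  · obtain ⟨δ, hδ, hsub⟩ := mem_nhdsGT_iff_exists_Ioc_subset.mp hE
    refine ⟨δ, hδ, fun t ht => ?_⟩
    -- The eventual hypotheses cover only `t > 0`; the endpoint uses `E k 0 = 0`.
    rcases ht.1.eq_or_lt with rfl | h0
    · simp [hE_zero]
    · exact hQ.blockRank_add A (hsub ⟨h0, ht.2⟩)
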